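/- **Syntax.** Fix countably infinite sets $\mathbb A$ of atoms and $\mathbb V$ of variables, and a signature $\Sigma$ consisting of term-formers $\mathsf f$ of arity $n\ge 0$ without equational theory and of binary commutative term-formers $\mathsf f^{C}$. A *finite permutation* is a bijection $\pi:\mathbb A\to\mathbb A$ whose domain $\mathrm{dom}(\pi)=\{a\mid \pi(a)\ne a\}$ is finite; $\mathrm{Perm}(\mathbb A)$ is the group of these and $\mathrm{Perm}(B)=\{\pi\in \mathrm{Perm}(\mathbb A)\mid\mathrm{dom}(\pi)\subseteq B\}$. Nominal terms are $t::=a\mid \pi\cdot X\mid \mathsf f(t_1,\dots,t_n)\mid \mathsf f^C(t_0,t_1)\mid [a]t$. Permutations act on terms by $\pi\cdot a=\pi(a)$, $\pi\cdot(\pi'\cdot X)=(\pi\circ\pi')\cdot X$, $\pi\cdot[a]t=[\pi(a)](\pi\cdot t)$, and argumentwise on applications. **Contexts.** A generalised fixed-point context $\Upsilon_{\bar c}$ is a finite set $\bar c$ of ($И$-quantified) atoms with a finite set $\Upsilon$ of constraints $\pi\curlywedge X$. For a finite permutation $\pi$, let $\pi_{\bar c}$ (resp. $\pi_{\neg\bar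 c}$) be the product of the disjoint cycles of $\pi$ that mention some (resp. no) atom of $\bar c$. Contexts are assumed to be in normal form: for each $\pi\curlywedge X\in\Upsilon$, $\pi_{\bar c}=\mathrm{id}$ or $\pi_{\neg\bar c}=\mathrm{id}$; and for all $\pi\curlywedge X,\ \pi'\curlywedge X\in\Upsilon$ on the same variable, $\mathrm{dom}(\pi_{\bar c})\cap\mathrm{dom}(\pi'_{\neg\bar c})=\emptyset$. For a variable $X$ put $$\mathcal P_X(\Upsilon_{\bar c})=\mathrm{Perm}\Bigl(\bar c\cup\bigcup_{\pi\curlywedge X\in\Upsilon}\mathrm{dom}(\pi_{\bar c})\Bigr)\circ\bigl\langle \pi_{\neg\bar c}\mid \pi\curlywedge X\in\Upsilon\bigr\rangle ,$$ where $H\circ K=\{h\circ k\mid h\in H,k\in K\}$. **Derivability.** $\Upsilon_{\bar c}\vdash t\approx_C u$ is defined inductively by the rules: 1. $\Upsilon_{\bar c}\vdash a\approx_C a$. 2. $\Upsilon_{\bar c}\vdash\pi\cdot X\approx_C\pi'\cdot X$ if $\pi'^{-1}\circ\pi\in\mathcal P_X(\Upsilon_{\bar c})$. 3. $\Upsilon_{\bar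 c}\vdash\mathsf f(t_1,\dots,t_n)\approx_C\mathsf f(t_1',\dots,t_n')$ if $\Upsilon_{\bar c}\vdash t_i\approx_C t_i'$ for all $i$. 4. $\Upsilon_{\bar c}\vdash\mathsf f^C(s_0,s_1)\approx_C\mathsf f^C(t_0,t_1)$ if, for $i=0$ or $i=1$, $\Upsilon_{\bar c}\vdash s_0\approx_C t_i$ and $\Upsilon_{\bar c}\vdash s_1\approx_C t_{1-i}$. 5. $\Upsilon_{\bar c}\vdash[a]t\approx_C[a]t'$ if $\Upsilon_{\bar c}\vdash t\approx_C t'$. 6. $\Upsilon_{\bar c}\vdash[a]t\approx_C[b]s$ if $\Upsilon_{\bar c,c_1}\vdash (a\ c_1)\cdot t\approx_C(b\ c_1)\cdot s$ for some atom $c_1$ not occurring in $\Upsilon_{\bar c},a,b,t,s$. **Semantics.** $И a.\,\varphi(a)$ means that $\varphi(a)$ holds for all but finitely many atoms $a$, and $И\bar c$ is the iterated quantifier $И c_1\dots И c_n$, which binds the names $\bar c$ wherever they are written in its scope. A commutative nominal $\Sigma$-algebra $\mathfrak A$ is a nominal set (a set with a $\mathrm{Perm}(\mathbb A)$-action all of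 whose elements are finitely supported) with an injective equivariant map $a\mapsto a^{\mathfrak A}$ from atoms, an equivariant map $\mathrm{abs}^{\mathfrak A}(a,x)$ with $И c.\,(a\ c)\cdot\mathrm{abs}^{\mathfrak A}(a,x)=\mathrm{abs}^{\mathfrak A}(a,x)$ for all $a,x$, an equivariant $n$-ary map for each $\mathsf f$ of arity $n$, and an equivariant binary map $f^{C,\mathfrak A}$ with $f^{C,\mathfrak A}(x,y)=f^{C,\mathfrak A}(y,x)$ for each $\mathsf f^C$. A valuation $\varsigma$ maps variables to elements of $\mathfrak A$; the interpretation is homomorphic, with $[\![\pi\cdot X]\!]_\varsigma=\pi\cdot\varsigma(X)$ and $[\![[a]t]\!]_\varsigma=\mathrm{abs}^{\mathfrak A}(a,[\![t]\!]_\varsigma)$. The judgement is *valid*, $\Upsilon_{\bar c}\models t\approx_C u$, if for every commutative nominal $\Sigma$-algebra $\mathfrak A$ and every valuation $\varsigma$: $$\text{if }\ И\bar c.\ \pi\cdot\varsigma(X)=\varsigma(X)\ \text{ for all }\pi\curlywedge X\in\Upsilon,\quad\text{then}\quad И\bar c.\ [\![t]\!]_\varsigma=[\![u]\!]_\varsigma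 .$$ **Theorem.** For every generalised fixed-point context $\Upsilon_{\bar c}$ in normal form and all nominal terms $t,u$: 1. (Soundness) if $\Upsilon_{\bar c}\vdash t\approx_C u$ then $\Upsilon_{\bar c}\models t\approx_C u$; 2. (Completeness) if $\Upsilon_{\bar c}\models t\approx_C u$ then $\Upsilon_{\bar c}\vdash t\approx_C u$. -/

import Mathlib

universe u w

namespace NominalC

/-! ### Finite permutations of atoms -/

/-- The group `Perm(𝔸)` of finite permutations: bijections moving only finitely many atoms. -/
def finPermSubgroup (𝔸 : Type) : Subgroup (Equiv.Perm 𝔸) where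
  carrier := {π | {a | π a ≠ a}.Finite}
  one_mem' := by simp
  mul_mem' := by
    intro π ρ hπ hρ
    refine (hπ.union hρ).subset ?_
    intro a ha
    by_contra hcon
    simp only [Set.mem_union, Set.mem_ofPred_eq, not_or, not_not] at hcon
    exact ha (by rw [Equiv.Perm.mul_apply, hcon.2, hcon.1])
  inv_mem' := by
    intro π hπ
    refine Set.Finite.subset hπ ?_
    intro a ha hcon
    exact ha (by rw [Equiv.Perm.inv_eq_iff_eq]; exact hcon.symm)

abbrev FinPerm (𝔸 : Type) : Type := ↥(finPermSubgroup 𝔸)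

namespace FinPerm

variable {𝔸 : Type}

/-- `dom(π)`, the set of atoms moved by `π`. -/
def dom (π : FinPerm 𝔸) : Set 𝔸 := {a | π.1 a ≠ a}

/-- The swapping `(a b)`. -/
def swap [DecidableEq 𝔸] (a b : 𝔸) : FinPerm 𝔸 :=
  ⟨Equiv.swap a b, by
    refine (Set.toFinite {a, b}).subset ?_
    intro x hx
    by_contra hcon
    simp only [Set.mem_insert_iff, Set.mem_singleton_iff, not_or] at hcon
    exact hx (Equiv.swap_apply_of_ne_of_ne hcon.1 hcon.2)⟩

open Classical in
/-- The finite permutation that agrees with `π` on a `π`-invariant set `p` of atoms, and fixes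
every other atom: the product of those disjoint cycles of `π` that lie in `p`. -/
noncomputable def restrict (π : FinPerm 𝔸) (p : 𝔸 → Prop) (h : ∀ a, p (π.1 a) ↔ p a) :
    FinPerm 𝔸 :=
  ⟨Equiv.Perm.ofSubtype (π.1.subtypePerm h), by
    refine Set.Finite.subset π.2 ?_
    intro a ha hcon
    apply ha
    by_cases hp : p a
    · rw [Equiv.Perm.ofSubtype_apply_of_mem _ hp]
      exact hcon
    · exact Equiv.Perm.ofSubtype_apply_of_not_mem _ hp⟩

theorem restrict_apply_of_mem (π : FinPerm 𝔸) (p : 𝔸 → Prop) (h : ∀ a, p (π.1 a) ↔ p a) {a : 𝔸}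
    (ha : p a) : (π.restrict p h).1 a = π.1 a := by
  classical
  exact Equiv.Perm.ofSubtype_apply_of_mem _ ha

theorem restrict_apply_of_not_mem (π : FinPerm 𝔸) (p : 𝔸 → Prop) (h : ∀ a, p (π.1 a) ↔ p a)
    {a : 𝔸} (ha : ¬ p a) : (π.restrict p h).1 a = a := by
  classical
  exact Equiv.Perm.ofSubtype_apply_of_not_mem _ ha

/-- The atom `a` lies on a cycle of `π` that mentions a name in `C`. -/
def OnNewCycle (π : FinPerm 𝔸) (C : Finset 𝔸) (a : 𝔸) : Prop :=
  ∃ c ∈ C, π.1.SameCycle c a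

theorem onNewCycle_apply (π : FinPerm 𝔸) (C : Finset 𝔸) (a : 𝔸) :
    π.OnNewCycle C (π.1 a) ↔ π.OnNewCycle C a := by
  simp only [OnNewCycle, Equiv.Perm.sameCycle_apply_right]

/-- `π_C`: the product of the disjoint cycles of `π` that mention a name in `C`. -/
noncomputable def newPart (π : FinPerm 𝔸) (C : Finset 𝔸) : FinPerm 𝔸 :=
  π.restrict (π.OnNewCycle C) (π.onNewCycle_apply C)

/-- `π_{¬C}`: the product of the disjoint cycles of `π` that mention no name in `C`. -/
noncomputable def oldPart (π : FinPerm 𝔸) (C : Finset 𝔸) : FinPerm 𝔸 :=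
  π.restrict (fun a => ¬ π.OnNewCycle C a) (fun a => not_congr (π.onNewCycle_apply C a))

end FinPerm

/-! ### Signatures and nominal terms -/

/-- A signature: term-formers `f : n` without equational theory, and commutative term-formers
`f^C`, which are binary. -/
structure Signature where
  Op : Type u
  arity : Op → ℕ
  COp : Type u

/-- Nominal terms over atoms `𝔸`, variables `𝕍` and the signature `Sg`:
`a`, `π·X`, `f(t₁,…,tₙ)`, `f^C(t₀,t₁)`, `[a]t`. -/
inductive Term (𝔸 𝕍 : Type) (Sg : Signature.{u}) : Type u
  | atom (a : 𝔸) : Term 𝔸 𝕍 Sg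
  | susp (π : FinPerm 𝔸) (X : 𝕍) : Term 𝔸 𝕍 Sg
  | app (f : Sg.Op) (ts : Fin (Sg.arity f) → Term 𝔸 𝕍 Sg) : Term 𝔸 𝕍 Sg
  | capp (f : Sg.COp) (t₀ t₁ : Term 𝔸 𝕍 Sg) : Term 𝔸 𝕍 Sg
  | abs (a : 𝔸) (t : Term 𝔸 𝕍 Sg) : Term 𝔸 𝕍 Sg

namespace Term

variable {𝔸 𝕍 : Type} {Sg : Signature.{u}}

/-- The atoms occurring in a term. -/
def atoms : Term 𝔸 𝕍 Sg → Set 𝔸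
  | atom a => {a}
  | susp π _ => π.dom
  | app _ ts => ⋃ i, (ts i).atoms
  | capp _ t₀ t₁ => t₀.atoms ∪ t₁.atoms
  | abs a t => insert a t.atoms

/-- The object-level permutation action `π · t`; on suspensions, `ρ · (π·X) = (ρ ∘ π)·X`. -/
def act (ρ : FinPerm 𝔸) : Term 𝔸 𝕍 Sg → Term 𝔸 𝕍 Sg
  | atom a => atom (ρ.1 a)
  | susp π X => susp (ρ * π) X
  | app f ts => app f (fun i => (ts i).act ρ)
  | capp f t₀ t₁ => capp f (t₀.act ρ) (t₁.act ρ)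
  | abs a t => abs (ρ.1 a) (t.act ρ)

/-- The renaming of the atoms written in a term along `ρ`. Unlike `act`, it does not act on the
variables: the suspended permutation of `π·X` is renamed to its conjugate `ρ ∘ π ∘ ρ⁻¹`. -/
def rename (ρ : FinPerm 𝔸) : Term 𝔸 𝕍 Sg → Term 𝔸 𝕍 Sg
  | atom a => atom (ρ.1 a)
  | susp π X => susp (ρ * π * ρ⁻¹) X
  | app f ts => app f (fun i => (ts i).rename ρ)
  | capp f t₀ t₁ => capp f (t₀.rename ρ) (t₁.rename ρ)
  | abs a t => abs (ρ.1 a) (t.rename ρ)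

end Term

/-! ### Fixed-point contexts -/

/-- A generalised fixed-point context `И c̄. Υ`: the finite set `names = c̄` of `И`-quantified
names, and the finite set `Υ` of primitive constraints `π ⋏ X`, each given as the pair
`(π, X)`. -/
structure FixCtx (𝔸 𝕍 : Type) where
  names : Finset 𝔸
  constraints : Finset (FinPerm 𝔸 × 𝕍)

namespace FixCtx

variable {𝔸 𝕍 : Type}

/-- The atoms of a context, including vacuously quantified names. -/
def atoms (Υ : FixCtx 𝔸 𝕍) : Set 𝔸 :=
  {a | a ∈ Υ.names ∨ ∃ p ∈ Υ.constraints, a ∈ p.1.dom}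

/-- `Υ_{c̄,c₁}`: one more `И`-quantified name, the same constraints. -/
def addName [DecidableEq 𝔸] (Υ : FixCtx 𝔸 𝕍) (c₁ : 𝔸) : FixCtx 𝔸 𝕍 where
  names := insert c₁ Υ.names
  constraints := Υ.constraints

/-- Normal form for the two normalisation rules:
no permutation mixes cycles with and cycles without quantified names, so that `(R1)` has nothing
to split, and no cycle without quantified names meets the domain of a freshness permutation on
the same variable, so that `(R2)` has nothing to merge. -/
def IsNormal (Υ : FixCtx 𝔸 𝕍) : Prop :=
  (∀ p ∈ Υ.constraints, p.1.newPart Υ.names = 1 ∨ p.1.oldPart Υ.names = 1) ∧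
  (∀ p ∈ Υ.constraints, ∀ q ∈ Υ.constraints, p.2 = q.2 →
    Disjoint (p.1.newPart Υ.names).dom (q.1.oldPart Υ.names).dom)

/-- The atoms of the freshness part of `Υ_{c̄}|_X`, including all quantified names. -/
def freshAtoms (Υ : FixCtx 𝔸 𝕍) (X : 𝕍) : Set 𝔸 :=
  {a | a ∈ Υ.names ∨ ∃ π, (π, X) ∈ Υ.constraints ∧ a ∈ (π.newPart Υ.names).dom}

/-- The permutations of the pure fixed-point part of `Υ_{c̄}|_X`. -/
def fixPerms (Υ : FixCtx 𝔸 𝕍) (X : 𝕍) : Set (FinPerm 𝔸) :=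
  {ρ | ∃ π, (π, X) ∈ Υ.constraints ∧ ρ = π.oldPart Υ.names}

/-- `Perm(atoms of the freshness part) ∘ ⟨permutations of the pure fixed-point part⟩`. -/
def permGroup (Υ : FixCtx 𝔸 𝕍) (X : 𝕍) : Set (FinPerm 𝔸) :=
  {ρ | ∃ η κ : FinPerm 𝔸, η.dom ⊆ Υ.freshAtoms X ∧ κ ∈ Subgroup.closure (Υ.fixPerms X) ∧
    ρ = η * κ}

end FixCtx

/-! ### Derivable judgements -/

/-- Derivability of the judgement `Υ_{c̄} ⊢ t ≈_C u`. In the rule for abstractions of two atoms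
the new `И`-quantified name `c₁` is fresh for everything in the conclusion. -/
inductive Derivable {𝔸 𝕍 : Type} [DecidableEq 𝔸] {Sg : Signature.{u}} :
    FixCtx 𝔸 𝕍 → Term 𝔸 𝕍 Sg → Term 𝔸 𝕍 Sg → Prop
  | atom (Υ : FixCtx 𝔸 𝕍) (a : 𝔸) : Derivable Υ (.atom a) (.atom a)
  | var (Υ : FixCtx 𝔸 𝕍) (π π' : FinPerm 𝔸) (X : 𝕍) (h : π'⁻¹ * π ∈ Υ.permGroup X) :
      Derivable Υ (.susp π X) (.susp π' X)
  | app (Υ : FixCtx 𝔸 𝕍) (f : Sg.Op) (ts ts' : Fin (Sg.arity f) → Term 𝔸 𝕍 Sg)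
      (h : ∀ i, Derivable Υ (ts i) (ts' i)) : Derivable Υ (.app f ts) (.app f ts')
  | capp (Υ : FixCtx 𝔸 𝕍) (f : Sg.COp) (s₀ s₁ t₀ t₁ : Term 𝔸 𝕍 Sg)
      (h₀ : Derivable Υ s₀ t₀) (h₁ : Derivable Υ s₁ t₁) :
      Derivable Υ (.capp f s₀ s₁) (.capp f t₀ t₁)
  | capp_swap (Υ : FixCtx 𝔸 𝕍) (f : Sg.COp) (s₀ s₁ t₀ t₁ : Term 𝔸 𝕍 Sg)
      (h₀ : Derivable Υ s₀ t₁) (h₁ : Derivable Υ s₁ t₀) :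
      Derivable Υ (.capp f s₀ s₁) (.capp f t₀ t₁)
  | abs (Υ : FixCtx 𝔸 𝕍) (a : 𝔸) (t t' : Term 𝔸 𝕍 Sg) (h : Derivable Υ t t') :
      Derivable Υ (.abs a t) (.abs a t')
  | abs_ab (Υ : FixCtx 𝔸 𝕍) (a b c₁ : 𝔸) (t s : Term 𝔸 𝕍 Sg)
      (hΥ : c₁ ∉ Υ.atoms) (ha : c₁ ≠ a) (hb : c₁ ≠ b) (ht : c₁ ∉ t.atoms) (hs : c₁ ∉ s.atoms)
      (h : Derivable (Υ.addName c₁) (t.act (FinPerm.swap a c₁)) (s.act (FinPerm.swap b c₁))) :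
      Derivable Υ (.abs a t) (.abs b s)

/-! ### The quantifier `И` -/

/-- `И a. φ(a)`: `φ` holds for all but finitely many atoms. -/
def New {𝔸 : Type} (φ : 𝔸 → Prop) : Prop := {a | φ a}ᶜ.Finite

/-- `И c₁. … И cₙ. φ` for a list of names `c₁, …, cₙ`, as iterated `И`. The quantified names are
instantiated by atoms `c₁', …, cₙ'`, and `φ` receives the renaming
`ρ = (c₁ c₁') ∘ … ∘ (cₙ cₙ')`; since `И` disregards finitely many instances, the `cᵢ'` may be
taken distinct and away from any finite set of atoms, so that renaming along `ρ` replaces every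
`cᵢ` by `cᵢ'` and leaves the other atoms alone. -/
def NewList {𝔸 : Type} [DecidableEq 𝔸] : List 𝔸 → (FinPerm 𝔸 → Prop) → Prop
  | [], φ => φ 1
  | c :: cs, φ => New fun c' => NewList cs fun ρ => φ (FinPerm.swap c c' * ρ)

/-- `И c̄. φ` for a finite set of names; the order of the names is immaterial. -/
noncomputable def NewSet {𝔸 : Type} [DecidableEq 𝔸] (C : Finset 𝔸) (φ : FinPerm 𝔸 → Prop) :
    Prop :=
  NewList C.toList φ

/-! ### Commutative nominal algebras -/

/-- A commutative nominal `Sg`-algebra, on a nominal set `carrier`. -/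
structure Algebra (𝔸 : Type) [DecidableEq 𝔸] (Sg : Signature.{u}) where
  carrier : Type w
  [action : MulAction (FinPerm 𝔸) carrier]
  /-- every element is finitely supported -/
  supported : ∀ x : carrier, ∃ B : Finset 𝔸, MulAction.Supports (FinPerm 𝔸) (B : Set 𝔸) x
  /-- interpretation of atoms -/
  atom : 𝔸 → carrier
  atom_injective : Function.Injective atom
  atom_equivariant : ∀ (π : FinPerm 𝔸) (a : 𝔸), π • atom a = atom (π.1 a)
  /-- interpretation of abstraction -/
  abs : 𝔸 → carrier → carrier
  abs_equivariant : ∀ (π : FinPerm 𝔸) (a : 𝔸) (x : carrier),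
    π • abs a x = abs (π.1 a) (π • x)
  abs_fresh : ∀ (a : 𝔸) (x : carrier), New fun c => FinPerm.swap a c • abs a x = abs a x
  /-- interpretation of the term-formers without equational theory -/
  op : ∀ f : Sg.Op, (Fin (Sg.arity f) → carrier) → carrier
  op_equivariant : ∀ (π : FinPerm 𝔸) (f : Sg.Op) (xs : Fin (Sg.arity f) → carrier),
    π • op f xs = op f (fun i => π • xs i)
  /-- interpretation of the commutative term-formers -/
  cop : Sg.COp → carrier → carrier → carrier
  cop_equivariant : ∀ (π : FinPerm 𝔸) (f : Sg.COp) (x y : carrier),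
    π • cop f x y = cop f (π • x) (π • y)
  cop_comm : ∀ (f : Sg.COp) (x y : carrier), cop f x y = cop f y x

attribute [instance] Algebra.action

namespace Algebra

variable {𝔸 𝕍 : Type} [DecidableEq 𝔸] {Sg : Signature.{u}}

/-- The interpretation of terms under a valuation `v`. -/
def interp (M : Algebra.{u, w} 𝔸 Sg) (v : 𝕍 → M.carrier) : Term 𝔸 𝕍 Sg → M.carrier
  | .atom a => M.atom a
  | .susp π X => π • v X
  | .app f ts => M.op f (fun i => M.interp v (ts i))
  | .capp f t₀ t₁ => M.cop f (M.interp v t₀) (M.interp v t₁)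
  | .abs a t => M.abs a (M.interp v t)

/-- The context is valid under `v`: `И c̄. π · v(X) = v(X)` for each constraint `π ⋏ X`. -/
def CtxValid (M : Algebra.{u, w} 𝔸 Sg) (v : 𝕍 → M.carrier) (Υ : FixCtx 𝔸 𝕍) : Prop :=
  ∀ p ∈ Υ.constraints, NewSet Υ.names fun ρ => (ρ * p.1 * ρ⁻¹) • v p.2 = v p.2

end Algebra

/-- Validity `Υ_{c̄} ⊨ t ≈_C u` of the judgement `И c̄. (Υ ⊢ t ≈_C u)` in all commutative nominal
algebras with carrier in the universe `w`, under all valuations. The names `c̄` are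
`И`-quantified in the whole judgement, so also in `t` and `u`. -/
def Valid {𝔸 𝕍 : Type} [DecidableEq 𝔸] {Sg : Signature.{u}}
    (Υ : FixCtx 𝔸 𝕍) (t s : Term 𝔸 𝕍 Sg) : Prop :=
  ∀ (M : Algebra.{u, w} 𝔸 Sg) (v : 𝕍 → M.carrier), M.CtxValid v Υ →
    NewSet Υ.names fun ρ => M.interp v (t.rename ρ) = M.interp v (s.rename ρ)

end NominalC

/-! Both directions replace `И` by one generic renaming `ρ`, which sends the names outside a large
finite set `B` and fixes the rest of `B`: a property of all such `ρ` gives `И`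
(`newSet_of_generic`), and `И` gives at least one such `ρ` (`exists_generic_of_newSet`).

Soundness. In a valuation satisfying a normal context, every non-name atom on a cycle through a name
is fresh for the value of its variable, and the old parts fix that value (`CtxValid.respects`).
Induction on derivations then shows that both sides agree under every sufficiently generic `ρ`
(`Derivable.interp_eq`).

Completeness. Let `S` be a finite set containing all atoms of the context and of both terms. Take
terms modulo bound atoms, commutativity, and `π·X = π'·X` whenever `π'⁻¹ ∘ π` lies in the group
generated by the old parts and by the permutations of the fresh atoms and the atoms outside `S`.
This algebra satisfies the context at `X ↦ id·X`, and each term denotes its own class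
(`termAlgebra_interp`). A generic `ρ` belongs to every one of these groups, so renaming by `ρ` is
acting by `ρ` and can be cancelled. The resulting `AlphaEq` becomes a derivation because the only
atoms outside `S` met on the way are names added for bound atoms (`AlphaEq.derivable`). -/

namespace NominalC

/-! ### Finite permutations: domains, conjugation, swappings -/

namespace FinPerm

variable {𝔸 : Type}

theorem ext_apply {π ρ : FinPerm 𝔸} (h : ∀ a, π.1 a = ρ.1 a) : π = ρ :=
  Subtype.ext (Equiv.ext h)

@[simp] theorem mul_apply (π ρ : FinPerm 𝔸) (a : 𝔸) : (π * ρ).1 a = π.1 (ρ.1 a) := rfl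

@[simp] theorem one_apply (a : 𝔸) : (1 : FinPerm 𝔸).1 a = a := rfl

@[simp] theorem inv_apply_self (π : FinPerm 𝔸) (a : 𝔸) : (π⁻¹).1 (π.1 a) = a :=
  π.1.symm_apply_apply a

@[simp] theorem apply_inv_self (π : FinPerm 𝔸) (a : 𝔸) : π.1 ((π⁻¹).1 a) = a :=
  π.1.apply_symm_apply a

theorem mem_dom {π : FinPerm 𝔸} {a : 𝔸} : a ∈ π.dom ↔ π.1 a ≠ a := Iff.rfl

theorem notMem_dom {π : FinPerm 𝔸} {a : 𝔸} : a ∉ π.dom ↔ π.1 a = a := not_not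

theorem dom_finite (π : FinPerm 𝔸) : π.dom.Finite := π.2

@[simp] theorem dom_one : (1 : FinPerm 𝔸).dom = ∅ := by
  ext a; simp [mem_dom]

theorem dom_mul_subset (π ρ : FinPerm 𝔸) : (π * ρ).dom ⊆ π.dom ∪ ρ.dom := by
  intro a ha
  by_contra h
  rw [Set.mem_union, not_or, notMem_dom, notMem_dom] at h
  exact ha (by rw [mul_apply, h.2, h.1])

theorem dom_inv (π : FinPerm 𝔸) : (π⁻¹).dom = π.dom := by
  ext a
  rw [← not_iff_not, notMem_dom, notMem_dom]
  constructor <;> intro h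
  · conv_lhs => rw [← h]
    simp
  · conv_lhs => rw [← h]
    simp

theorem mem_dom_conj {ρ π : FinPerm 𝔸} {a : 𝔸} (h : a ∈ (ρ * π * ρ⁻¹).dom) :
    ∃ b ∈ π.dom, ρ.1 b = a := by
  refine ⟨(ρ⁻¹).1 a, fun hb => h ?_, by simp⟩
  simp only [mul_apply, hb, apply_inv_self]

theorem mul_comm_of_fixes {τ π : FinPerm 𝔸} (h : ∀ a ∈ π.dom, τ.1 a = a) : τ * π = π * τ := by
  have hd : Equiv.Perm.Disjoint τ.1 π.1 := fun a => by
    by_cases ha : a ∈ π.dom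
    · exact Or.inl (h a ha)
    · exact Or.inr (notMem_dom.1 ha)
  exact Subtype.ext hd.commute.eq

theorem conj_eq_self {τ π : FinPerm 𝔸} (h : ∀ a ∈ π.dom, τ.1 a = a) : τ * π * τ⁻¹ = π := by
  rw [mul_comm_of_fixes h, mul_inv_cancel_right]

/-- The quotient `σ⁻¹ * ρ` fixes the domain of `π` pointwise, hence commutes with `π`. -/
theorem conj_congr {ρ σ π : FinPerm 𝔸} (h : ∀ a ∈ π.dom, ρ.1 a = σ.1 a) :
    ρ * π * ρ⁻¹ = σ * π * σ⁻¹ := by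
  have := conj_eq_self (τ := σ⁻¹ * ρ) (π := π) (fun a ha => by simp [h a ha])
  calc ρ * π * ρ⁻¹ = σ * ((σ⁻¹ * ρ) * π * (σ⁻¹ * ρ)⁻¹) * σ⁻¹ := by group
    _ = _ := by rw [this]

theorem conj_zpow_apply (ρ π : FinPerm 𝔸) (k : ℤ) (c : 𝔸) :
    ((ρ * π * ρ⁻¹) ^ k).1 (ρ.1 c) = ρ.1 ((π.1 ^ k) c) := by
  rw [conj_zpow]
  simp

section Swap

variable [DecidableEq 𝔸]

@[simp] theorem swap_val (a b : 𝔸) : (swap a b).1 = Equiv.swap a b := rfl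

theorem mul_swap (π : FinPerm 𝔸) (a b : 𝔸) :
    π * swap a b = swap (π.1 a) (π.1 b) * π :=
  Subtype.ext (Equiv.mul_swap_eq_swap_mul π.1 a b)

theorem swap_mul_self (a b : 𝔸) : swap a b * swap a b = 1 :=
  Subtype.ext (Equiv.swap_mul_self a b)

theorem swap_fixes {a b c : 𝔸} (ha : c ≠ a) (hb : c ≠ b) : (swap a b).1 c = c :=
  Equiv.swap_apply_of_ne_of_ne ha hb

/-- A property of finite permutations that holds of `1` and is stable under multiplication by
swappings of atoms in `F` holds of every permutation with domain in `F`. -/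
theorem swap_induction {F : Set 𝔸} {P : FinPerm 𝔸 → Prop} (one : P 1)
    (swap_mul : ∀ a ∈ F, ∀ b ∈ F, ∀ π, P π → P (swap a b * π)) (π : FinPerm 𝔸)
    (hπ : π.dom ⊆ F) : P π := by
  induction hn : π.dom.ncard using Nat.strong_induction_on generalizing π with
  | _ n ih =>
    by_cases h : ∃ a, π.1 a ≠ a
    · obtain ⟨a, ha⟩ := h
      have ha' : π.1 a ∈ π.dom := fun h => ha (π.1.injective h)
      -- This factor fixes `a` and moves nothing that `π` fixes, so its domain is strictly smaller.
      set σ := swap a (π.1 a) * π with hσ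
      have hsub : σ.dom ⊆ π.dom := by
        intro x hx
        by_contra hxd
        have hx' := notMem_dom.1 hxd
        refine hx ?_
        rw [hσ, mul_apply, hx']
        refine swap_fixes ?_ ?_
        · rintro rfl; exact hxd ha
        · rintro rfl; exact hxd ha'
      have hss : σ.dom ⊂ π.dom := by
        refine ⟨hsub, fun h => h (show a ∈ π.dom from ha) ?_⟩
        rw [hσ, mul_apply]
        exact Equiv.swap_apply_right _ _
      have hP := ih _ (hn ▸ Set.ncard_lt_ncard hss π.dom_finite) σ (hsub.trans hπ) rfl
      have : π = swap a (π.1 a) * σ := by rw [hσ, ← mul_assoc, swap_mul_self, one_mul]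
      rw [this]
      exact swap_mul _ (hπ ha) _ (hπ ha') _ hP
    · have : π = 1 := ext_apply fun a => by simpa using not_exists.1 h a
      rwa [this]

end Swap

/-! ### New and old parts -/

theorem onNewCycle_of_mem {π : FinPerm 𝔸} {C : Finset 𝔸} {a : 𝔸} (h : a ∈ C) :
    π.OnNewCycle C a := ⟨a, h, Equiv.Perm.SameCycle.refl _ _⟩

theorem onNewCycle_of_mem_dom_newPart {π : FinPerm 𝔸} {C : Finset 𝔸} {a : 𝔸}
    (h : a ∈ (π.newPart C).dom) : π.OnNewCycle C a := by
  by_contra hn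
  exact h (restrict_apply_of_not_mem _ _ _ hn)

theorem not_onNewCycle_of_mem_dom_oldPart {π : FinPerm 𝔸} {C : Finset 𝔸} {a : 𝔸}
    (h : a ∈ (π.oldPart C).dom) : ¬ π.OnNewCycle C a := by
  by_contra hn
  exact h (restrict_apply_of_not_mem _ _ _ (not_not.2 hn))

theorem newPart_apply {π : FinPerm 𝔸} {C : Finset 𝔸} {a : 𝔸} (h : π.OnNewCycle C a) :
    (π.newPart C).1 a = π.1 a := restrict_apply_of_mem _ _ _ h

theorem oldPart_apply {π : FinPerm 𝔸} {C : Finset 𝔸} {a : 𝔸} (h : ¬ π.OnNewCycle C a) :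
    (π.oldPart C).1 a = π.1 a := restrict_apply_of_mem _ _ _ h

theorem newPart_apply_of_not {π : FinPerm 𝔸} {C : Finset 𝔸} {a : 𝔸} (h : ¬ π.OnNewCycle C a) :
    (π.newPart C).1 a = a := restrict_apply_of_not_mem _ _ _ h

theorem oldPart_apply_of_not {π : FinPerm 𝔸} {C : Finset 𝔸} {a : 𝔸} (h : π.OnNewCycle C a) :
    (π.oldPart C).1 a = a := restrict_apply_of_not_mem _ _ _ (not_not.2 h)

theorem newPart_mul_oldPart (π : FinPerm 𝔸) (C : Finset 𝔸) :
    π.newPart C * π.oldPart C = π := by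
  refine ext_apply fun a => ?_
  rw [mul_apply]
  by_cases h : π.OnNewCycle C a
  · rw [oldPart_apply_of_not h, newPart_apply h]
  · rw [oldPart_apply h, newPart_apply_of_not (by rwa [onNewCycle_apply])]

theorem dom_oldPart_subset (π : FinPerm 𝔸) (C : Finset 𝔸) : (π.oldPart C).dom ⊆ π.dom := by
  intro a ha
  rw [mem_dom, oldPart_apply (not_onNewCycle_of_mem_dom_oldPart ha)] at ha
  exact ha

theorem dom_newPart_subset (π : FinPerm 𝔸) (C : Finset 𝔸) : (π.newPart C).dom ⊆ π.dom := by
  intro a ha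
  rw [mem_dom, newPart_apply (onNewCycle_of_mem_dom_newPart ha)] at ha
  exact ha

/-- A name fixed by `π` forms a cycle of its own, so quantifying it puts no moved atom on a new
cycle. -/
theorem onNewCycle_insert [DecidableEq 𝔸] {π : FinPerm 𝔸} {C : Finset 𝔸} {c a : 𝔸}
    (hc : c ∉ π.dom) (ha : a ∈ π.dom) : π.OnNewCycle (insert c C) a ↔ π.OnNewCycle C a := by
  constructor
  · rintro ⟨d, hd, k, hk⟩
    rcases Finset.mem_insert.1 hd with rfl | hd
    · rw [Equiv.Perm.zpow_apply_eq_self_of_apply_eq_self (notMem_dom.1 hc)] at hk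
      exact absurd ha (hk ▸ hc)
    · exact ⟨d, hd, k, hk⟩
  · rintro ⟨d, hd, h⟩
    exact ⟨d, Finset.mem_insert_of_mem hd, h⟩

theorem newPart_insert [DecidableEq 𝔸] {π : FinPerm 𝔸} {C : Finset 𝔸} {c : 𝔸}
    (hc : c ∉ π.dom) : π.newPart (insert c C) = π.newPart C := by
  refine ext_apply fun a => ?_
  by_cases ha : a ∈ π.dom
  · by_cases h : π.OnNewCycle C a
    · rw [newPart_apply h, newPart_apply ((onNewCycle_insert hc ha).2 h)]
    · rw [newPart_apply_of_not h, newPart_apply_of_not (mt (onNewCycle_insert hc ha).1 h)]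
  · rw [notMem_dom.1 fun h => ha (dom_newPart_subset _ _ h),
      notMem_dom.1 fun h => ha (dom_newPart_subset _ _ h)]

theorem oldPart_insert [DecidableEq 𝔸] {π : FinPerm 𝔸} {C : Finset 𝔸} {c : 𝔸}
    (hc : c ∉ π.dom) : π.oldPart (insert c C) = π.oldPart C := by
  have h₁ := newPart_mul_oldPart π C
  have h₂ := newPart_mul_oldPart π (insert c C)
  rw [newPart_insert hc] at h₂
  exact mul_left_cancel (h₂.trans h₁.symm)

end FinPerm

/-! ### Atoms of contexts, and extension by a fresh name -/

namespace FixCtx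

variable {𝔸 𝕍 : Type}

theorem atoms_finite (Υ : FixCtx 𝔸 𝕍) : Υ.atoms.Finite := by
  refine (Υ.names.finite_toSet.union
    (Υ.constraints.finite_toSet.biUnion fun p _ => p.1.dom_finite)).subset ?_
  rintro a (h | ⟨p, hp, h⟩)
  · exact Or.inl h
  · exact Or.inr (Set.mem_biUnion (Finset.mem_coe.2 hp) h)

theorem fixPerms_dom {Υ : FixCtx 𝔸 𝕍} {X : 𝕍} {κ : FinPerm 𝔸} (h : κ ∈ Υ.fixPerms X) :
    κ.dom ⊆ Υ.atoms \ Υ.names := by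
  obtain ⟨π, hπ, rfl⟩ := h
  intro a ha
  exact ⟨Or.inr ⟨_, hπ, FinPerm.dom_oldPart_subset _ _ ha⟩, fun hn =>
    FinPerm.not_onNewCycle_of_mem_dom_oldPart ha (FinPerm.onNewCycle_of_mem hn)⟩

theorem dom_subset_of_mem_closure {K : Set (FinPerm 𝔸)} {A : Set 𝔸} (hK : ∀ κ ∈ K, κ.dom ⊆ A)
    {κ : FinPerm 𝔸} (h : κ ∈ Subgroup.closure K) : κ.dom ⊆ A := by
  induction h using Subgroup.closure_induction with
  | mem x hx => exact hK x hx
  | one => simp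
  | mul x y _ _ hx hy => exact (FinPerm.dom_mul_subset x y).trans (Set.union_subset hx hy)
  | inv x _ hx => rwa [FinPerm.dom_inv]

theorem freshAtoms_subset_atoms (Υ : FixCtx 𝔸 𝕍) (X : 𝕍) : Υ.freshAtoms X ⊆ Υ.atoms := by
  rintro a (h | ⟨π, hπ, h⟩)
  · exact Or.inl h
  · exact Or.inr ⟨_, hπ, FinPerm.dom_newPart_subset _ _ h⟩

/-- The second normal-form clause handles new parts; the names themselves never lie in the domain of
an old part. This disjointness later makes the two factors of `permGroup` commute. -/
theorem IsNormal.disjoint {Υ : FixCtx 𝔸 𝕍} (h : Υ.IsNormal) {X : 𝕍} {κ : FinPerm 𝔸}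
    (hκ : κ ∈ Υ.fixPerms X) : Disjoint (Υ.freshAtoms X) κ.dom := by
  rw [Set.disjoint_left]
  rintro a (ha | ⟨π, hπ, ha⟩) hd
  · exact (fixPerms_dom hκ hd).2 ha
  · obtain ⟨σ, hσ, rfl⟩ := hκ
    exact Set.disjoint_left.1 (h.2 _ hπ _ hσ rfl) ha hd

section AddName

variable [DecidableEq 𝔸]

theorem fixPerms_addName {Υ : FixCtx 𝔸 𝕍} {c : 𝔸} (hc : c ∉ Υ.atoms) (X : 𝕍) :
    (Υ.addName c).fixPerms X = Υ.fixPerms X := by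
  ext ρ
  refine exists_congr fun π => and_congr_right fun hπ => ?_
  rw [show (Υ.addName c).names = insert c Υ.names from rfl,
    FinPerm.oldPart_insert fun h => hc (Or.inr ⟨_, hπ, h⟩)]

theorem freshAtoms_addName {Υ : FixCtx 𝔸 𝕍} {c : 𝔸} (hc : c ∉ Υ.atoms) (X : 𝕍) :
    (Υ.addName c).freshAtoms X = insert c (Υ.freshAtoms X) := by
  ext a
  have : (∃ π, (π, X) ∈ (Υ.addName c).constraints ∧ a ∈ (π.newPart (Υ.addName c).names).dom) ↔
      ∃ π, (π, X) ∈ Υ.constraints ∧ a ∈ (π.newPart Υ.names).dom := by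
    refine exists_congr fun π => and_congr_right fun hπ => ?_
    rw [show (Υ.addName c).names = insert c Υ.names from rfl,
      FinPerm.newPart_insert fun h => hc (Or.inr ⟨_, hπ, h⟩)]
  change _ ∨ _ ↔ a = c ∨ _ ∨ _
  rw [this, ← or_assoc]
  exact or_congr_left Finset.mem_insert

end AddName

end FixCtx

/-! ### Action and renaming on terms -/

namespace Term

variable {𝔸 𝕍 : Type} {Sg : Signature.{u}}

theorem atoms_finite (t : Term 𝔸 𝕍 Sg) : t.atoms.Finite := by
  induction t with
  | atom a => exact Set.finite_singleton a
  | susp π X => exact π.dom_finite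
  | app f ts ih => exact Set.finite_iUnion ih
  | capp f t₀ t₁ h₀ h₁ => exact h₀.union h₁
  | abs a t h => exact h.insert a

@[simp] theorem act_one (t : Term 𝔸 𝕍 Sg) : t.act 1 = t := by
  induction t with
  | atom a => rfl
  | susp π X => simp [act]
  | app f ts ih => simp [act, ih]
  | capp f t₀ t₁ h₀ h₁ => simp [act, h₀, h₁]
  | abs a t h => simp [act, h]

theorem act_mul (ρ σ : FinPerm 𝔸) (t : Term 𝔸 𝕍 Sg) : t.act (ρ * σ) = (t.act σ).act ρ := by
  induction t with
  | atom a => rfl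
  | susp π X => simp [act, mul_assoc]
  | app f ts ih => simp [act, ih]
  | capp f t₀ t₁ h₀ h₁ => simp [act, h₀, h₁]
  | abs a t h => simp [act, h]

theorem atoms_act_subset (ρ : FinPerm 𝔸) (t : Term 𝔸 𝕍 Sg) :
    (t.act ρ).atoms ⊆ ρ.dom ∪ t.atoms := by
  have key : ∀ a, ρ.1 a ∈ ρ.dom ∪ {a} := fun a => by
    by_cases h : ρ.1 a = a
    · exact Or.inr h
    · exact Or.inl fun h' => h (ρ.1.injective h')
  induction t with
  | atom a => exact Set.singleton_subset_iff.2 (key a)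
  | susp π X => exact FinPerm.dom_mul_subset ρ π
  | app f ts ih =>
    refine Set.iUnion_subset fun i => (ih i).trans (Set.union_subset_union_right _ ?_)
    exact Set.subset_iUnion (fun i => (ts i).atoms) i
  | capp f t₀ t₁ h₀ h₁ =>
    exact Set.union_subset (h₀.trans (Set.union_subset_union_right _ Set.subset_union_left))
      (h₁.trans (Set.union_subset_union_right _ Set.subset_union_right))
  | abs a t h =>
    refine Set.insert_subset ?_ (h.trans (Set.union_subset_union_right _ (Set.subset_insert _ _)))
    exact Set.union_subset_union_right _ (Set.singleton_subset_iff.2 (Set.mem_insert _ _)) (key a)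

theorem rename_congr {ρ σ : FinPerm 𝔸} {t : Term 𝔸 𝕍 Sg} (h : ∀ a ∈ t.atoms, ρ.1 a = σ.1 a) :
    t.rename ρ = t.rename σ := by
  induction t with
  | atom a => simp [rename, h a rfl]
  | susp π X => simp only [rename, FinPerm.conj_congr h]
  | app f ts ih =>
    simp only [rename]
    congr
    funext i
    exact ih i fun a ha => h a (Set.mem_iUnion.2 ⟨i, ha⟩)
  | capp f t₀ t₁ h₀ h₁ =>
    simp only [rename, h₀ fun a ha => h a (Or.inl ha), h₁ fun a ha => h a (Or.inr ha)]
  | abs a t ih =>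
    simp only [rename, ih fun a ha => h a (Or.inr ha), h a (Or.inl rfl)]

theorem rename_act (ρ σ : FinPerm 𝔸) (t : Term 𝔸 𝕍 Sg) :
    (t.act σ).rename ρ = (t.rename ρ).act (ρ * σ * ρ⁻¹) := by
  induction t with
  | atom a => simp [rename, act]
  | susp π X => simp only [rename, act]; congr 1; group
  | app f ts ih => simp [rename, act, ih]
  | capp f t₀ t₁ h₀ h₁ => simp only [rename, act, h₀, h₁]
  | abs a t h => simp [rename, act, h]

end Term

/-! ### Generic instances of the `И`-quantified names -/

section Generic

variable {𝔸 : Type}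

/-- `ρ` moves the names `C` away from `B` and leaves the other atoms of `B` alone. -/
def Generic (C B : Finset 𝔸) (ρ : FinPerm 𝔸) : Prop :=
  (∀ c ∈ C, ρ.1 c ∉ B) ∧ ∀ a ∈ B, a ∉ C → ρ.1 a = a

theorem Generic.mono {C B B' : Finset 𝔸} {ρ : FinPerm 𝔸} (h : Generic C B' ρ) (hB : B ⊆ B') :
    Generic C B ρ :=
  ⟨fun c hc hb => h.1 c hc (hB hb), fun a ha hc => h.2 a (hB ha) hc⟩

variable [DecidableEq 𝔸]

/-- Inductive step for `NewList`: `ρ` instantiates the remaining names and `d` instantiates `c`.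
Since `ρ` already avoids `c` and `d` on `C`, the final swapping leaves its instances alone. -/
theorem Generic.swap_mul {C B B' : Finset 𝔸} {ρ : FinPerm 𝔸} {c d : 𝔸} (h : Generic C B' ρ)
    (hB : B ⊆ B') (hc : c ∈ B') (hd : ∀ e ∈ C, ρ.1 e ≠ d) (hdB : d ∉ B) (hcC : c ∉ C) :
    Generic (insert c C) B (FinPerm.swap c d * ρ) := by
  refine ⟨fun e he => ?_, fun a ha haC => ?_⟩
  · rcases Finset.mem_insert.1 he with rfl | he
    · simpa [h.2 e hc hcC] using hdB
    · have h₁ : ρ.1 e ≠ c := fun h' => h.1 e he (h' ▸ hc)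
      rw [FinPerm.mul_apply, FinPerm.swap_fixes h₁ (hd e he)]
      exact fun h' => h.1 e he (hB h')
  · rw [Finset.mem_insert, not_or] at haC
    rw [FinPerm.mul_apply, h.2 a (hB ha) haC.2]
    exact FinPerm.swap_fixes haC.1 fun h' => hdB (h' ▸ ha)

theorem newList_of_generic {l : List 𝔸} (hl : l.Nodup) {φ : FinPerm 𝔸 → Prop} (B : Finset 𝔸)
    (h : ∀ ρ, Generic l.toFinset B ρ → φ ρ) : NewList l φ := by
  induction l generalizing φ B with
  | nil => exact h 1 ⟨by simp, by simp⟩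
  | cons c cs ih =>
    rw [List.nodup_cons] at hl
    refine B.finite_toSet.subset fun d hd => ?_
    by_contra hdB
    refine hd (ih hl.2 (insert c (insert d B)) fun ρ hρ => h _ ?_)
    rw [List.toFinset_cons]
    refine hρ.swap_mul (fun a ha => by simp [ha]) (by simp) (fun e he h' => ?_) hdB (by simpa using hl.1)
    exact hρ.1 e he (by simp [h'])

theorem exists_generic_of_newList [Infinite 𝔸] {l : List 𝔸} (hl : l.Nodup)
    {φ : FinPerm 𝔸 → Prop} (B : Finset 𝔸) (h : NewList l φ) :
    ∃ ρ, Generic l.toFinset B ρ ∧ φ ρ := by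
  induction l generalizing φ B with
  | nil => exact ⟨1, ⟨by simp, by simp⟩, h⟩
  | cons c cs ih =>
    rw [List.nodup_cons] at hl
    have hfin : ({d | NewList cs fun ρ => φ (FinPerm.swap c d * ρ)}ᶜ ∪ B : Set 𝔸).Finite :=
      Set.Finite.union h B.finite_toSet
    obtain ⟨d, hd⟩ := hfin.exists_notMem
    rw [Set.mem_union, not_or, Set.mem_compl_iff, not_not] at hd
    obtain ⟨ρ, hρ, hφ⟩ := ih hl.2 (insert c (insert d B)) hd.1
    refine ⟨_, ?_, hφ⟩
    rw [List.toFinset_cons]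
    refine hρ.swap_mul (fun a ha => by simp [ha]) (by simp) (fun e he h' => ?_) hd.2 (by simpa using hl.1)
    exact hρ.1 e he (by simp [h'])

theorem newSet_of_generic {C : Finset 𝔸} {φ : FinPerm 𝔸 → Prop} (B : Finset 𝔸)
    (h : ∀ ρ, Generic C B ρ → φ ρ) : NewSet C φ :=
  newList_of_generic C.nodup_toList B (by simpa using h)

theorem exists_generic_of_newSet [Infinite 𝔸] {C : Finset 𝔸} {φ : FinPerm 𝔸 → Prop}
    (B : Finset 𝔸) (h : NewSet C φ) : ∃ ρ, Generic C B ρ ∧ φ ρ := by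
  simpa using exists_generic_of_newList C.nodup_toList B h

end Generic

/-! ### Freshness in nominal sets -/

section Fresh

variable {𝔸 : Type} {α : Type*} [MulAction (FinPerm 𝔸) α]

/-- `a # x`: some finite support of `x` avoids `a`. -/
def Fresh (a : 𝔸) (x : α) : Prop :=
  ∃ B : Finset 𝔸, MulAction.Supports (FinPerm 𝔸) (B : Set 𝔸) x ∧ a ∉ B

theorem smul_eq_of_supports {B : Finset 𝔸} {x : α}
    (hB : MulAction.Supports (FinPerm 𝔸) (B : Set 𝔸) x) {π : FinPerm 𝔸}
    (h : ∀ a ∈ B, π.1 a = a) : π • x = x :=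
  hB π fun {a} ha => h a ha

/-- If `B` supports `x`, then `π(B)` supports `π • x`, which is `x` here. -/
theorem Fresh.apply {a : 𝔸} {x : α} {π : FinPerm 𝔸} (h : Fresh a x) (hπ : π • x = x) :
    Fresh (π.1 a) x := by
  obtain ⟨B, hB, ha⟩ := h
  refine ⟨B.map π.1.toEmbedding, fun σ hσ => ?_, by simpa using ha⟩
  have : (π⁻¹ * σ * π) • x = x := by
    refine smul_eq_of_supports hB fun b hb => ?_
    have : σ.1 (π.1 b) = π.1 b := hσ (by simpa using hb)
    simp [this]
  rw [mul_smul, mul_smul, hπ, inv_smul_eq_iff, hπ] at this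
  exact this

variable [DecidableEq 𝔸] [Infinite 𝔸]

theorem Fresh.swap_smul {a b : 𝔸} {x : α} (ha : Fresh a x) (hb : Fresh b x) :
    FinPerm.swap a b • x = x := by
  obtain ⟨A, hA, ha⟩ := ha
  obtain ⟨B, hB, hb⟩ := hb
  obtain ⟨c, hc⟩ := (A ∪ B ∪ {a, b}).exists_notMem
  simp only [Finset.mem_union, Finset.mem_insert, Finset.mem_singleton, not_or] at hc
  have h₁ : FinPerm.swap a c • x = x := smul_eq_of_supports hA fun d hd =>
    FinPerm.swap_fixes (fun h => ha (h ▸ hd)) (fun h => hc.1.1 (h ▸ hd))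
  have h₂ : FinPerm.swap b c • x = x := smul_eq_of_supports hB fun d hd =>
    FinPerm.swap_fixes (fun h => hb (h ▸ hd)) (fun h => hc.1.2 (h ▸ hd))
  by_cases hab : a = b
  · subst hab
    have : FinPerm.swap a a = 1 := Subtype.ext (Equiv.swap_self a)
    rw [this, one_smul]
  -- With `c` outside both supports, `(a c)` and `(b c)` fix `x`; `(a b)` is a conjugate of one by
  -- the other.
  have h₃ : FinPerm.swap a c * FinPerm.swap b c = FinPerm.swap b a * FinPerm.swap a c := by
    rw [FinPerm.mul_swap, FinPerm.swap_fixes (Ne.symm hab) (Ne.symm hc.2.2)]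
    simp
  have h₄ : (FinPerm.swap b a * FinPerm.swap a c) • x = x := by
    rw [← h₃, mul_smul, h₂, h₁]
  rw [mul_smul, h₁] at h₄
  rwa [show FinPerm.swap a b = FinPerm.swap b a from Subtype.ext (Equiv.swap_comm a b)]

theorem smul_eq_of_dom_fresh {π : FinPerm 𝔸} {x : α} (h : ∀ a ∈ π.dom, Fresh a x) :
    π • x = x := by
  refine FinPerm.swap_induction (F := {a | Fresh a x}) (P := fun π => π • x = x) (one_smul _ _)
    (fun a ha b hb π hπ => ?_) π h
  rw [mul_smul, hπ, Fresh.swap_smul ha hb]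

end Fresh

/-! ### Soundness -/

namespace Algebra

variable {𝔸 𝕍 : Type} [DecidableEq 𝔸] {Sg : Signature.{u}}

theorem interp_act (M : Algebra.{u, w} 𝔸 Sg) (v : 𝕍 → M.carrier) (ρ : FinPerm 𝔸)
    (t : Term 𝔸 𝕍 Sg) : M.interp v (t.act ρ) = ρ • M.interp v t := by
  induction t with
  | atom a => exact (M.atom_equivariant ρ a).symm
  | susp π X => exact mul_smul ρ π (v X)
  | app f ts ih => simp only [Term.act, interp, ih, M.op_equivariant]
  | capp f t₀ t₁ h₀ h₁ => simp only [Term.act, interp, h₀, h₁, M.cop_equivariant]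
  | abs a t h => simp only [Term.act, interp, h, M.abs_equivariant]

/-- Renaming differs from acting only by a factor `ρ⁻¹` applied to each variable, which is invisible
when `ρ` fixes the values. -/
theorem interp_rename (M : Algebra.{u, w} 𝔸 Sg) (v : 𝕍 → M.carrier) (ρ : FinPerm 𝔸)
    (hρ : ∀ X, ρ • v X = v X) (t : Term 𝔸 𝕍 Sg) :
    M.interp v (t.rename ρ) = ρ • M.interp v t := by
  induction t with
  | atom a => exact (M.atom_equivariant ρ a).symm
  | susp π X =>
    have : ρ⁻¹ • v X = v X := inv_smul_eq_iff.2 (hρ X).symm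
    simp only [Term.rename, interp, mul_smul, this]
  | app f ts ih => simp only [Term.rename, interp, ih, M.op_equivariant]
  | capp f t₀ t₁ h₀ h₁ => simp only [Term.rename, interp, h₀, h₁, M.cop_equivariant]
  | abs a t h => simp only [Term.rename, interp, h, M.abs_equivariant]

/-- The valuation satisfies the freshness and fixed-point assumptions of the context, read
without the `И`-quantified names. -/
def Respects (M : Algebra.{u, w} 𝔸 Sg) (v : 𝕍 → M.carrier) (Υ : FixCtx 𝔸 𝕍) : Prop :=
  ∀ X, (∀ a ∈ Υ.freshAtoms X, a ∉ Υ.names → Fresh a (v X)) ∧ ∀ κ ∈ Υ.fixPerms X, κ • v X = v X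

theorem Respects.addName {M : Algebra.{u, w} 𝔸 Sg} {v : 𝕍 → M.carrier} {Υ : FixCtx 𝔸 𝕍}
    (h : M.Respects v Υ) {c : 𝔸} (hc : c ∉ Υ.atoms) : M.Respects v (Υ.addName c) := by
  intro X
  rw [FixCtx.fixPerms_addName hc, FixCtx.freshAtoms_addName hc]
  refine ⟨fun a ha haN => (h X).1 a (ha.resolve_left ?_) ?_, (h X).2⟩
  · rintro rfl; exact haN (Finset.mem_insert_self _ _)
  · exact fun h' => haN (Finset.mem_insert_of_mem h')

theorem CtxValid.respects [Infinite 𝔸] {M : Algebra.{u, w} 𝔸 Sg} {v : 𝕍 → M.carrier}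
    {Υ : FixCtx 𝔸 𝕍} (h : M.CtxValid v Υ) (hΥ : Υ.IsNormal) : M.Respects v Υ := by
  have key : ∀ π X, (π, X) ∈ Υ.constraints → ∃ ρ : FinPerm 𝔸,
      (∀ c ∈ Υ.names, Fresh (ρ.1 c) (v X)) ∧ (∀ a ∈ π.dom, a ∉ Υ.names → ρ.1 a = a) ∧
      (ρ * π * ρ⁻¹) • v X = v X := by
    intro π X hπ
    obtain ⟨B, hB⟩ := M.supported (v X)
    obtain ⟨ρ, hρ, hfix⟩ := exists_generic_of_newSet (B ∪ π.dom_finite.toFinset) (h _ hπ)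
    refine ⟨ρ, fun c hc => ⟨B, hB, fun hB' => hρ.1 c hc ?_⟩, fun a ha => hρ.2 a ?_, hfix⟩
    · exact Finset.mem_union_left _ hB'
    · exact Finset.mem_union_right _ (by simpa using ha)
  refine fun X => ⟨?_, ?_⟩
  · rintro a (ha | ⟨π, hπ, ha⟩) haN
    · exact absurd ha haN
    obtain ⟨ρ, hρ, hρ', hfix⟩ := key π X hπ
    obtain ⟨c, hc, k, hk⟩ := FinPerm.onNewCycle_of_mem_dom_newPart ha
    -- The `k`-th power of the renamed permutation fixes the value and carries the fresh atom `ρ c`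
    -- to `ρ a = a`, so `a` is fresh as well.
    have hk' : ((ρ * π * ρ⁻¹) ^ k) • v X = v X :=
      Subgroup.zpow_mem (MulAction.stabilizer (FinPerm 𝔸) (v X)) hfix k
    have := (hρ c hc).apply hk'
    rwa [FinPerm.conj_zpow_apply, hk, hρ' a (FinPerm.dom_newPart_subset _ _ ha) haN] at this
  · rintro κ ⟨π, hπ, rfl⟩
    -- By the first normal-form clause, either `π` is its own old part and is unchanged by the
    -- renaming, or the old part is trivial.
    rcases hΥ.1 _ hπ with h₁ | h₁
    · have hold : π.oldPart Υ.names = π := by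
        have := π.newPart_mul_oldPart Υ.names
        rwa [show π.newPart Υ.names = 1 from h₁, one_mul] at this
      obtain ⟨ρ, -, hρ, hfix⟩ := key π X hπ
      rw [FinPerm.conj_eq_self fun a ha => hρ a ha ?_] at hfix
      · rwa [hold]
      · rw [← hold] at ha
        exact fun hn => FinPerm.not_onNewCycle_of_mem_dom_oldPart ha (FinPerm.onNewCycle_of_mem hn)
    · rw [show π.oldPart Υ.names = 1 from h₁, one_smul]

/-- Alpha-conversion inside an algebra, valid for almost every new bound atom `d`. -/
theorem abs_eq_of_fresh (M : Algebra.{u, w} 𝔸 Sg) (a : 𝔸) (x : M.carrier) :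
    {d | ¬ M.abs a x = M.abs d (FinPerm.swap a d • x)}.Finite := by
  refine Set.Finite.subset (M.abs_fresh a x) fun d hd h => hd ?_
  have h' : FinPerm.swap a d • M.abs a x = M.abs a x := h
  rw [M.abs_equivariant] at h'
  simpa using h'.symm

end Algebra

theorem Derivable.interp_eq {𝔸 𝕍 : Type} [DecidableEq 𝔸] [Infinite 𝔸] {Sg : Signature.{u}}
    {Υ : FixCtx 𝔸 𝕍} {t s : Term 𝔸 𝕍 Sg} (h : Derivable Υ t s) (M : Algebra.{u, w} 𝔸 Sg)
    (v : 𝕍 → M.carrier) (hv : M.Respects v Υ) :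
    ∃ B : Finset 𝔸, ∀ ρ, Generic Υ.names B ρ →
      M.interp v (t.rename ρ) = M.interp v (s.rename ρ) := by
  induction h with
  | atom Υ a => exact ⟨∅, fun _ _ => rfl⟩
  | var Υ π π' X h =>
    obtain ⟨η, κ, hη, hκ, hηκ⟩ := h
    obtain ⟨B, hB⟩ := M.supported (v X)
    refine ⟨B ∪ η.dom_finite.toFinset ∪ κ.dom_finite.toFinset, fun ρ hρ => ?_⟩
    have hκv : κ ∈ MulAction.stabilizer (FinPerm 𝔸) (v X) :=
      (Subgroup.closure_le _).2 (fun σ hσ => (hv X).2 σ hσ) hκ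
    -- Renaming leaves `κ` unchanged because its domain contains no names; it turns `η` into a
    -- permutation of atoms fresh for `v X`.
    have h₁ : ρ * κ * ρ⁻¹ = κ := FinPerm.conj_eq_self fun a ha =>
      hρ.2 a (by simp [ha]) (FixCtx.dom_subset_of_mem_closure (fun _ => FixCtx.fixPerms_dom) hκ ha).2
    have h₂ : (ρ * η * ρ⁻¹) • v X = v X := by
      refine smul_eq_of_dom_fresh fun a ha => ?_
      obtain ⟨b, hb, rfl⟩ := FinPerm.mem_dom_conj ha
      by_cases hbN : b ∈ Υ.names
      · exact ⟨B, hB, fun h => hρ.1 b hbN (by simp [h])⟩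
      · rw [hρ.2 b (by simp [hb]) hbN]
        exact (hv X).1 b (hη hb) hbN
    have h₃ : ρ * π * ρ⁻¹ = (ρ * π' * ρ⁻¹) * ((ρ * η * ρ⁻¹) * (ρ * κ * ρ⁻¹)) := by
      rw [inv_mul_eq_iff_eq_mul.1 hηκ]; group
    simp only [Term.rename, Algebra.interp]
    rw [h₃, h₁, mul_smul (ρ * π' * ρ⁻¹), mul_smul (ρ * η * ρ⁻¹), hκv, h₂]
  | app Υ f ts ts' _ ih =>
    choose B hB using fun i => ih i hv
    refine ⟨Finset.univ.biUnion B, fun ρ hρ => ?_⟩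
    simp only [Term.rename, Algebra.interp]
    congr 1
    funext i
    exact hB i ρ (hρ.mono (Finset.subset_biUnion_of_mem B (Finset.mem_univ i)))
  | capp Υ f s₀ s₁ t₀ t₁ _ _ ih₀ ih₁ =>
    obtain ⟨B₀, h₀⟩ := ih₀ hv
    obtain ⟨B₁, h₁⟩ := ih₁ hv
    refine ⟨B₀ ∪ B₁, fun ρ hρ => ?_⟩
    simp only [Term.rename, Algebra.interp]
    rw [h₀ ρ (hρ.mono Finset.subset_union_left), h₁ ρ (hρ.mono Finset.subset_union_right)]
  | capp_swap Υ f s₀ s₁ t₀ t₁ _ _ ih₀ ih₁ =>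
    obtain ⟨B₀, h₀⟩ := ih₀ hv
    obtain ⟨B₁, h₁⟩ := ih₁ hv
    refine ⟨B₀ ∪ B₁, fun ρ hρ => ?_⟩
    simp only [Term.rename, Algebra.interp]
    rw [h₀ ρ (hρ.mono Finset.subset_union_left), h₁ ρ (hρ.mono Finset.subset_union_right),
      M.cop_comm]
  | abs Υ a t t' _ ih =>
    obtain ⟨B, hB⟩ := ih hv
    refine ⟨B, fun ρ hρ => ?_⟩
    simp only [Term.rename, Algebra.interp]
    rw [hB ρ hρ]
  | abs_ab Υ a b c t s hΥ ha hb ht hs _ ih =>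
    obtain ⟨B, hB⟩ := ih (hv.addName hΥ)
    -- Putting `c` into the set forces `ρ c = c`, as `c` is not a name of the smaller context.
    refine ⟨insert c B, fun ρ hρ => ?_⟩
    have hcN : c ∉ Υ.names := fun h => hΥ (Or.inl h)
    have hρc : ρ.1 c = c := hρ.2 c (by simp) hcN
    set x := M.interp v (t.rename ρ) with hx
    set y := M.interp v (s.rename ρ) with hy
    have hfin : ({d | ¬ M.abs (ρ.1 a) x = M.abs d (FinPerm.swap (ρ.1 a) d • x)} ∪
        {d | ¬ M.abs (ρ.1 b) y = M.abs d (FinPerm.swap (ρ.1 b) d • y)} ∪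
        (ρ.1 '' (Υ.names ∪ {a, b} ∪ t.atoms ∪ s.atoms)) ∪ B : Set 𝔸).Finite :=
      ((((M.abs_eq_of_fresh _ x).union (M.abs_eq_of_fresh _ y))).union
        ((((Υ.names.finite_toSet.union (Set.toFinite _)).union t.atoms_finite).union
          s.atoms_finite).image _)).union B.finite_toSet
    -- A common bound atom `d` for both abstractions, which also instantiates the added name: `(c d)
    -- ∘ ρ` is generic for the extended context.
    obtain ⟨d, hd⟩ := hfin.exists_notMem
    simp only [Set.mem_union, not_or, Set.mem_ofPred_eq, not_not] at hd
    obtain ⟨⟨⟨hdx, hdy⟩, hdρ⟩, hdB⟩ := hd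
    have hgen := hρ.swap_mul (c := c) (d := d) (Finset.subset_insert c B) (by simp)
      (fun e he h => hdρ ⟨e, Or.inl (Or.inl (Or.inl he)), h⟩) hdB hcN
    have hfix : ∀ e, e ∈ (Υ.names ∪ {a, b} ∪ t.atoms ∪ s.atoms : Set 𝔸) → e ≠ c →
        (FinPerm.swap c d * ρ).1 e = ρ.1 e := fun e he hec =>
      FinPerm.swap_fixes (fun h => hec (ρ.1.injective (h.trans hρc.symm)))
        (fun h => hdρ ⟨e, he, h⟩)
    have hc' : (FinPerm.swap c d * ρ).1 c = d := by
      rw [FinPerm.mul_apply, hρc]; exact Equiv.swap_apply_left c d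
    have key : ∀ (e : 𝔸) (r : Term 𝔸 𝕍 Sg),
        (∀ f ∈ insert e r.atoms, (FinPerm.swap c d * ρ).1 f = ρ.1 f) →
        M.interp v ((r.act (FinPerm.swap e c)).rename (FinPerm.swap c d * ρ)) =
          FinPerm.swap (ρ.1 e) d • M.interp v (r.rename ρ) := by
      intro e r hr
      rw [Term.rename_act, Term.rename_congr fun f hf => hr f (Or.inr hf), FinPerm.mul_swap, hc',
        hr e (Or.inl rfl), mul_inv_cancel_right, M.interp_act]
    have := hB _ hgen
    rw [key a t, key b s] at this
    · simp only [Term.rename, Algebra.interp]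
      rw [← hx, ← hy, hdx, hdy, this]
    · rintro f (rfl | hf)
      · exact hfix _ (by simp) hb.symm
      · exact hfix _ (Or.inr hf) fun h => hs (h ▸ hf)
    · rintro f (rfl | hf)
      · exact hfix _ (by simp) ha.symm
      · exact hfix _ (Or.inl (Or.inr hf)) fun h => ht (h ▸ hf)

theorem Derivable.valid {𝔸 𝕍 : Type} [DecidableEq 𝔸] [Infinite 𝔸] {Sg : Signature.{u}}
    {Υ : FixCtx 𝔸 𝕍} (hΥ : Υ.IsNormal) {t s : Term 𝔸 𝕍 Sg} (h : Derivable Υ t s) :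
    Valid.{u, w} Υ t s := fun M v hv =>
  let ⟨B, hB⟩ := h.interp_eq M v (hv.respects hΥ)
  newSet_of_generic B hB

/-! ### Terms up to renaming of bound atoms, commutativity and symmetries of the variables -/

section TermModel

variable {𝔸 𝕍 : Type} [DecidableEq 𝔸] {Sg : Signature.{u}}

/-- Equality of terms up to bound atoms and commutativity, where `π·X` only depends on the
coset of `π` modulo `G X`. -/
inductive AlphaEq (G : 𝕍 → Subgroup (FinPerm 𝔸)) : Term 𝔸 𝕍 Sg → Term 𝔸 𝕍 Sg → Prop
  | atom (a : 𝔸) : AlphaEq G (.atom a) (.atom a)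
  | susp (π π' : FinPerm 𝔸) (X : 𝕍) (h : π'⁻¹ * π ∈ G X) : AlphaEq G (.susp π X) (.susp π' X)
  | app (f : Sg.Op) (ts ts' : Fin (Sg.arity f) → Term 𝔸 𝕍 Sg)
      (h : ∀ i, AlphaEq G (ts i) (ts' i)) : AlphaEq G (.app f ts) (.app f ts')
  | capp (f : Sg.COp) (s₀ s₁ t₀ t₁ : Term 𝔸 𝕍 Sg) (h₀ : AlphaEq G s₀ t₀) (h₁ : AlphaEq G s₁ t₁) :
      AlphaEq G (.capp f s₀ s₁) (.capp f t₀ t₁)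
  | capp_swap (f : Sg.COp) (s₀ s₁ t₀ t₁ : Term 𝔸 𝕍 Sg) (h₀ : AlphaEq G s₀ t₁)
      (h₁ : AlphaEq G s₁ t₀) : AlphaEq G (.capp f s₀ s₁) (.capp f t₀ t₁)
  -- Asking for all `c` outside a finite set makes transitivity a union of exceptional sets and
  -- equivariance an enlargement by the domain of the permutation.
  | abs (a b : 𝔸) (t s : Term 𝔸 𝕍 Sg) (L : Set 𝔸) (hL : L.Finite)
      (h : ∀ c ∉ L, AlphaEq G (t.act (FinPerm.swap a c)) (s.act (FinPerm.swap b c))) :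
      AlphaEq G (.abs a t) (.abs b s)

namespace AlphaEq

variable {G : 𝕍 → Subgroup (FinPerm 𝔸)}

theorem act {t s : Term 𝔸 𝕍 Sg} (h : AlphaEq G t s) (ρ : FinPerm 𝔸) :
    AlphaEq G (t.act ρ) (s.act ρ) := by
  induction h with
  | atom a => exact atom _
  | susp π π' X h =>
    refine susp _ _ _ ?_
    rwa [mul_inv_rev, mul_assoc, inv_mul_cancel_left]
  | app f ts ts' _ ih => exact app _ _ _ ih
  | capp f s₀ s₁ t₀ t₁ _ _ h₀ h₁ => exact capp _ _ _ _ _ h₀ h₁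
  | capp_swap f s₀ s₁ t₀ t₁ _ _ h₀ h₁ => exact capp_swap _ _ _ _ _ h₀ h₁
  | abs a b t s L hL _ ih =>
    refine abs _ _ _ _ (L ∪ ρ.dom) (hL.union ρ.dom_finite) fun c hc => ?_
    rw [Set.mem_union, not_or, FinPerm.notMem_dom] at hc
    have := ih c hc.1
    rwa [← Term.act_mul, ← Term.act_mul, FinPerm.mul_swap, FinPerm.mul_swap, hc.2, Term.act_mul,
      Term.act_mul] at this

theorem abs_congr {t s : Term 𝔸 𝕍 Sg} (a : 𝔸) (h : AlphaEq G t s) :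
    AlphaEq G (.abs a t) (.abs a s) :=
  abs _ _ _ _ ∅ Set.finite_empty fun _ _ => h.act _

theorem refl (t : Term 𝔸 𝕍 Sg) : AlphaEq G t t := by
  induction t with
  | atom a => exact atom a
  | susp π X => exact susp _ _ _ (by rw [inv_mul_cancel]; exact one_mem _)
  | app f ts ih => exact app _ _ _ ih
  | capp f t₀ t₁ h₀ h₁ => exact capp _ _ _ _ _ h₀ h₁
  | abs a t h => exact abs_congr a h

theorem symm {t s : Term 𝔸 𝕍 Sg} (h : AlphaEq G t s) : AlphaEq G s t := by
  induction h with
  | atom a => exact atom _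
  | susp π π' X h =>
    refine susp _ _ _ ?_
    simpa using inv_mem h
  | app f ts ts' _ ih => exact app _ _ _ ih
  | capp f s₀ s₁ t₀ t₁ _ _ h₀ h₁ => exact capp _ _ _ _ _ h₀ h₁
  | capp_swap f s₀ s₁ t₀ t₁ _ _ h₀ h₁ => exact capp_swap _ _ _ _ _ h₁ h₀
  | abs a b t s L hL _ ih => exact abs _ _ _ _ L hL ih

theorem trans {t s r : Term 𝔸 𝕍 Sg} (h : AlphaEq G t s) (h' : AlphaEq G s r) :
    AlphaEq G t r := by
  induction h generalizing r with
  | atom a => exact h'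
  | susp π π' X h =>
    cases h' with
    | susp _ π'' _ h' =>
      refine susp _ _ _ ?_
      simpa [mul_assoc] using mul_mem h' h
  | app f ts ts' _ ih =>
    cases h' with
    | app _ _ _ h' => exact app _ _ _ fun i => ih i (h' i)
  | capp f s₀ s₁ t₀ t₁ _ _ h₀ h₁ =>
    cases h' with
    | capp _ _ _ _ _ h₂ h₃ => exact capp _ _ _ _ _ (h₀ h₂) (h₁ h₃)
    | capp_swap _ _ _ _ _ h₂ h₃ => exact capp_swap _ _ _ _ _ (h₀ h₂) (h₁ h₃)
  | capp_swap f s₀ s₁ t₀ t₁ _ _ h₀ h₁ =>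
    cases h' with
    | capp _ _ _ _ _ h₂ h₃ => exact capp_swap _ _ _ _ _ (h₀ h₃) (h₁ h₂)
    | capp_swap _ _ _ _ _ h₂ h₃ => exact capp _ _ _ _ _ (h₀ h₃) (h₁ h₂)
  | abs a b t s L hL _ ih =>
    cases h' with
    | abs _ _ _ _ L' hL' h' =>
      refine abs _ _ _ _ (L ∪ L') (hL.union hL') fun c hc => ?_
      rw [Set.mem_union, not_or] at hc
      exact ih c hc.1 (h' c hc.2)

/-- On a suspension `σ·X`, `π` commutes past `σ` and is absorbed by `G X`. Thus `S ∪ t.atoms`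
supports the class of `t`. -/
theorem act_of_fixes {S : Set 𝔸} (hS : ∀ X (π : FinPerm 𝔸), Disjoint π.dom S → π ∈ G X)
    {t : Term 𝔸 𝕍 Sg} {π : FinPerm 𝔸} (hπ : ∀ a ∈ S, π.1 a = a)
    (ht : ∀ a ∈ t.atoms, π.1 a = a) : AlphaEq G (t.act π) t := by
  induction t with
  | atom a => rw [Term.act, ht a rfl]; exact atom a
  | susp σ X =>
    refine susp _ _ _ ?_
    rw [FinPerm.mul_comm_of_fixes ht, inv_mul_cancel_left]
    exact hS X π (Set.disjoint_left.2 fun a ha hS => ha (hπ a hS))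
  | app f ts ih => exact app _ _ _ fun i => ih i fun a ha => ht a (Set.mem_iUnion.2 ⟨i, ha⟩)
  | capp f t₀ t₁ h₀ h₁ =>
    exact capp _ _ _ _ _ (h₀ fun a ha => ht a (Or.inl ha)) (h₁ fun a ha => ht a (Or.inr ha))
  | abs a t h =>
    rw [Term.act, ht a (Or.inl rfl)]
    exact abs_congr a (h fun b hb => ht b (Or.inr hb))

theorem abs_swap {S : Set 𝔸} (hfin : S.Finite)
    (hS : ∀ X (π : FinPerm 𝔸), Disjoint π.dom S → π ∈ G X) {t : Term 𝔸 𝕍 Sg} {a c : 𝔸}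
    (hcS : c ∉ S) (hct : c ∉ t.atoms) (hca : c ≠ a) :
    AlphaEq G (.abs c (t.act (FinPerm.swap a c))) (.abs a t) := by
  refine abs _ _ _ _ (S ∪ t.atoms ∪ {a, c}) ((hfin.union t.atoms_finite).union (Set.toFinite _))
    fun d hd => ?_
  simp only [Set.mem_union, Set.mem_insert_iff, Set.mem_singleton_iff, not_or] at hd
  have h : FinPerm.swap c d * FinPerm.swap a c = FinPerm.swap a d * FinPerm.swap c d := by
    rw [FinPerm.mul_swap, FinPerm.swap_fixes hca.symm (Ne.symm hd.2.1)]
    simp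
  rw [← Term.act_mul, h, Term.act_mul]
  refine (act_of_fixes hS (fun e he => ?_) (fun e he => ?_)).act _
  · exact FinPerm.swap_fixes (fun h => hcS (h ▸ he)) (fun h => hd.1.1 (h ▸ he))
  · exact FinPerm.swap_fixes (fun h => hct (h ▸ he)) (fun h => hd.1.2 (h ▸ he))

end AlphaEq

/-- The setoid of `AlphaEq`. -/
def alphaSetoid (Sg : Signature.{u}) (G : 𝕍 → Subgroup (FinPerm 𝔸)) : Setoid (Term 𝔸 𝕍 Sg) :=
  ⟨AlphaEq G, AlphaEq.refl, AlphaEq.symm, AlphaEq.trans⟩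

instance (Sg : Signature.{u}) (G : 𝕍 → Subgroup (FinPerm 𝔸)) :
    MulAction (FinPerm 𝔸) (Quotient (alphaSetoid Sg G)) where
  smul ρ := Quotient.map (Term.act ρ) fun _ _ h => h.act ρ
  one_smul := by
    rintro ⟨t⟩
    exact congrArg (Quotient.mk _) (Term.act_one t)
  mul_smul := by
    rintro ρ σ ⟨t⟩
    exact congrArg (Quotient.mk _) (Term.act_mul ρ σ t)

/-- The term-former `f` on classes of terms. -/
noncomputable def quotApp {G : 𝕍 → Subgroup (FinPerm 𝔸)} (f : Sg.Op)
    (xs : Fin (Sg.arity f) → Quotient (alphaSetoid Sg G)) : Quotient (alphaSetoid Sg G) :=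
  Quotient.mk _ (.app f fun i => (xs i).out)

/-- The chosen representatives do not matter. -/
theorem quotApp_mk {G : 𝕍 → Subgroup (FinPerm 𝔸)} (f : Sg.Op)
    (ts : Fin (Sg.arity f) → Term 𝔸 𝕍 Sg) :
    quotApp f (fun i => Quotient.mk (alphaSetoid Sg G) (ts i)) = Quotient.mk _ (.app f ts) :=
  Quotient.sound (AlphaEq.app _ _ _ fun i => Quotient.mk_out (s := alphaSetoid Sg G) (ts i))

/-- The algebra of classes of terms, when the groups `G X` contain all permutations away from a
finite set `S`. -/
noncomputable def termAlgebra (Sg : Signature.{u}) (G : 𝕍 → Subgroup (FinPerm 𝔸)) (S : Finset 𝔸)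
    (hS : ∀ X (π : FinPerm 𝔸), Disjoint π.dom S → π ∈ G X) : Algebra.{u, u} 𝔸 Sg where
  carrier := Quotient (alphaSetoid Sg G)
  supported := by
    rintro ⟨t⟩
    refine ⟨S ∪ t.atoms_finite.toFinset, fun π hπ => Quotient.sound ?_⟩
    exact AlphaEq.act_of_fixes hS (fun a ha => hπ (by simpa using Or.inl ha))
      (fun a ha => hπ (by simpa using Or.inr ha))
  atom a := Quotient.mk _ (.atom a)
  atom_injective a b h := by
    cases Quotient.exact h
    rfl
  atom_equivariant _ _ := rfl
  abs a := Quotient.map (.abs a) fun _ _ h => AlphaEq.abs_congr a h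
  abs_equivariant := by
    rintro π a ⟨t⟩
    rfl
  abs_fresh := by
    rintro a ⟨t⟩
    refine ((S.finite_toSet.union t.atoms_finite).union (Set.finite_singleton a)).subset
      fun c hc => ?_
    by_contra hcon
    simp only [Set.mem_union, Set.mem_singleton_iff, not_or] at hcon
    refine hc (Quotient.sound ?_)
    change AlphaEq G (.abs ((FinPerm.swap a c).1 a) (t.act (FinPerm.swap a c))) (.abs a t)
    rw [FinPerm.swap_val, Equiv.swap_apply_left]
    exact AlphaEq.abs_swap S.finite_toSet hS hcon.1.1 hcon.1.2 hcon.2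
  op := quotApp
  op_equivariant π f xs := by
    obtain ⟨ts, rfl⟩ : ∃ ts : Fin (Sg.arity f) → Term 𝔸 𝕍 Sg,
      xs = fun i => Quotient.mk _ (ts i) := ⟨fun i => (xs i).out, by simp⟩
    rw [quotApp_mk]
    exact (quotApp_mk f fun i => (ts i).act π).symm
  cop f := Quotient.map₂ (.capp f) fun _ _ h₀ _ _ h₁ => AlphaEq.capp _ _ _ _ _ h₀ h₁
  cop_equivariant := by
    rintro π f ⟨t⟩ ⟨s⟩
    rfl
  cop_comm := by
    rintro f ⟨t⟩ ⟨s⟩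
    exact Quotient.sound (AlphaEq.capp_swap _ _ _ _ _ (AlphaEq.refl _) (AlphaEq.refl _))

theorem termAlgebra_interp {G : 𝕍 → Subgroup (FinPerm 𝔸)} {S : Finset 𝔸}
    (hS : ∀ X (π : FinPerm 𝔸), Disjoint π.dom S → π ∈ G X) (t : Term 𝔸 𝕍 Sg) :
    (termAlgebra Sg G S hS).interp (fun X => Quotient.mk _ (.susp 1 X)) t = Quotient.mk _ t := by
  induction t with
  | atom a => rfl
  | susp π X =>
    refine (congrArg (Quotient.mk _) ?_ : Quotient.mk _ (Term.act π (.susp 1 X)) = _)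
    simp [Term.act]
  | app f ts ih =>
    simp only [Algebra.interp, ih]
    exact quotApp_mk f ts
  | capp f t₀ t₁ h₀ h₁ =>
    simp only [Algebra.interp, h₀, h₁]
    rfl
  | abs a t h =>
    simp only [Algebra.interp, h]
    rfl

end TermModel

/-! ### Completeness -/

namespace FixCtx

variable {𝔸 𝕍 : Type}

/-- The symmetries of `X` when, in addition to the constraints of a normal context, all atoms
outside `S ⊇ Υ.atoms` are fresh for `X`. -/
def symmetries (Υ : FixCtx 𝔸 𝕍) (hΥ : Υ.IsNormal) (S : Finset 𝔸) (hS : Υ.atoms ⊆ S) (X : 𝕍) :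
    Subgroup (FinPerm 𝔸) :=
  -- The factors have disjoint domains: `κ` stays inside `S` and, by normality, off the fresh atoms.
  -- Hence the products form a subgroup.
  have comm : ∀ {η κ : FinPerm 𝔸}, η.dom ⊆ Υ.freshAtoms X ∪ (S : Set 𝔸)ᶜ →
      κ ∈ Subgroup.closure (Υ.fixPerms X) → η * κ = κ * η := fun {η κ} hη hκ => by
    refine FinPerm.mul_comm_of_fixes fun a ha => FinPerm.notMem_dom.1 fun ha' => ?_
    have h₁ := dom_subset_of_mem_closure (A := (Υ.freshAtoms X)ᶜ ∩ S) (fun σ hσ b hb =>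
      ⟨fun hb' => Set.disjoint_left.1 (hΥ.disjoint hσ) hb' hb, hS (fixPerms_dom hσ hb).1⟩) hκ ha
    exact (hη ha').elim h₁.1 fun h => h h₁.2
  { carrier := {ρ | ∃ η κ : FinPerm 𝔸, η.dom ⊆ Υ.freshAtoms X ∪ (S : Set 𝔸)ᶜ ∧
      κ ∈ Subgroup.closure (Υ.fixPerms X) ∧ ρ = η * κ}
    one_mem' := ⟨1, 1, by simp, one_mem _, (one_mul 1).symm⟩
    mul_mem' := by
      rintro _ _ ⟨η, κ, hη, hκ, rfl⟩ ⟨η', κ', hη', hκ', rfl⟩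
      refine ⟨η * η', κ * κ', (FinPerm.dom_mul_subset _ _).trans (Set.union_subset hη hη'),
        mul_mem hκ hκ', ?_⟩
      rw [mul_assoc, ← mul_assoc κ, ← comm hη' hκ, mul_assoc, mul_assoc]
    inv_mem' := by
      rintro _ ⟨η, κ, hη, hκ, rfl⟩
      refine ⟨η⁻¹, κ⁻¹, by rwa [FinPerm.dom_inv], inv_mem hκ, ?_⟩
      rw [comm hη hκ, mul_inv_rev] }

end FixCtx

/-- The context `Υ'` varies because passing under a binder adds a name, while the groups stay those
of `Υ`. -/
theorem AlphaEq.derivable {𝔸 𝕍 : Type} [DecidableEq 𝔸] [Infinite 𝔸] {Sg : Signature.{u}}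
    {Υ : FixCtx 𝔸 𝕍} {hΥ : Υ.IsNormal} {S : Finset 𝔸} {hS : Υ.atoms ⊆ S} {t s : Term 𝔸 𝕍 Sg}
    (h : AlphaEq (Υ.symmetries hΥ S hS) t s) (Υ' : FixCtx 𝔸 𝕍)
    (hfix : ∀ X, Υ.fixPerms X ⊆ Υ'.fixPerms X) (hfresh : ∀ X, Υ.freshAtoms X ⊆ Υ'.freshAtoms X)
    (ht : t.atoms ⊆ S ∪ Υ'.names) (hs : s.atoms ⊆ S ∪ Υ'.names) : Derivable Υ' t s := by
  induction h generalizing Υ' with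
  | atom a => exact .atom _ _
  | susp π π' X h =>
    obtain ⟨η, κ, hη, hκ, h⟩ := h
    refine .var _ _ _ _ ⟨η, κ, fun a ha => ?_, Subgroup.closure_mono (hfix X) hκ, h⟩
    rcases hη ha with h' | h'
    · exact hfresh X h'
    -- Solving for `η` bounds its domain by atoms of the two terms and of `κ`, so any atom of it
    -- outside `S` is a name of `Υ'`.
    have hη' : η = π'⁻¹ * π * κ⁻¹ := by rw [h, mul_inv_cancel_right]
    have hκS : κ.dom ⊆ S := FixCtx.dom_subset_of_mem_closure
      (fun σ hσ b hb => hS (FixCtx.fixPerms_dom hσ hb).1) hκ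
    rw [hη'] at ha
    have ha' : a ∈ (S ∪ Υ'.names : Set 𝔸) := by
      rcases FinPerm.dom_mul_subset _ _ ha with ha | ha
      · rcases FinPerm.dom_mul_subset _ _ ha with ha | ha
        · exact hs ((FinPerm.dom_inv π').subset ha)
        · exact ht ha
      · exact Or.inl (hκS ((FinPerm.dom_inv κ).subset ha))
    exact Or.inl (ha'.resolve_left h')
  | app f ts ts' _ ih =>
    exact .app _ _ _ _ fun i => ih i Υ' hfix hfresh ((Set.iUnion_subset_iff.1 ht) i)
      ((Set.iUnion_subset_iff.1 hs) i)
  | capp f s₀ s₁ t₀ t₁ _ _ h₀ h₁ =>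
    obtain ⟨hs₀, hs₁⟩ := Set.union_subset_iff.1 ht
    obtain ⟨ht₀, ht₁⟩ := Set.union_subset_iff.1 hs
    exact .capp _ _ _ _ _ _ (h₀ Υ' hfix hfresh hs₀ ht₀) (h₁ Υ' hfix hfresh hs₁ ht₁)
  | capp_swap f s₀ s₁ t₀ t₁ _ _ h₀ h₁ =>
    obtain ⟨hs₀, hs₁⟩ := Set.union_subset_iff.1 ht
    obtain ⟨ht₀, ht₁⟩ := Set.union_subset_iff.1 hs
    exact .capp_swap _ _ _ _ _ _ (h₀ Υ' hfix hfresh hs₀ ht₁) (h₁ Υ' hfix hfresh hs₁ ht₀)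
  | abs a b t s L hL _ ih =>
    obtain ⟨c, hc⟩ := ((hL.union (S.finite_toSet.union Υ'.names.finite_toSet)).union
      Υ'.atoms_finite).exists_notMem
    simp only [Set.mem_union, not_or] at hc
    obtain ⟨⟨hcL, hcS⟩, hcΥ⟩ := hc
    obtain ⟨ha, ht⟩ := Set.insert_subset_iff.1 ht
    obtain ⟨hb, hs⟩ := Set.insert_subset_iff.1 hs
    have hc' : c ∉ (S ∪ Υ'.names : Set 𝔸) := not_or.2 hcS
    have key : ∀ (e : 𝔸) (r : Term 𝔸 𝕍 Sg), e ∈ (S ∪ Υ'.names : Set 𝔸) →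
        r.atoms ⊆ S ∪ Υ'.names →
        (r.act (FinPerm.swap e c)).atoms ⊆ S ∪ (Υ'.addName c).names := by
      intro e r he hr
      have hsub : (S ∪ Υ'.names : Set 𝔸) ⊆ S ∪ (Υ'.addName c).names :=
        Set.union_subset_union_right _ (Finset.coe_subset.2 (Finset.subset_insert _ _))
      refine (Term.atoms_act_subset _ r).trans (Set.union_subset (fun x hx => ?_) (hr.trans hsub))
      by_contra hcon
      refine hx (FinPerm.swap_fixes ?_ ?_)
      · rintro rfl; exact hcon (hsub he)
      · rintro rfl; exact hcon (Or.inr (Finset.mem_insert_self _ _))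
    -- The two-atom rule also serves when `a = b`.
    refine .abs_ab Υ' a b c t s hcΥ (fun h => hc' (h ▸ ha)) (fun h => hc' (h ▸ hb))
      (fun h => hc' (ht h)) (fun h => hc' (hs h)) (ih c hcL _ (fun X => ?_) (fun X => ?_)
      (key a t ha ht) (key b s hb hs))
    · rw [FixCtx.fixPerms_addName hcΥ]
      exact hfix X
    · rw [FixCtx.freshAtoms_addName hcΥ]
      exact (hfresh X).trans (Set.subset_insert _ _)

theorem Valid.derivable {𝔸 𝕍 : Type} [DecidableEq 𝔸] [Infinite 𝔸] {Sg : Signature.{u}}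
    {Υ : FixCtx 𝔸 𝕍} (hΥ : Υ.IsNormal) {t s : Term 𝔸 𝕍 Sg} (h : Valid.{u, u} Υ t s) :
    Derivable Υ t s := by
  set S : Finset 𝔸 :=
    ((Υ.atoms_finite.union t.atoms_finite).union s.atoms_finite).toFinset with hSdef
  have hS : Υ.atoms ⊆ S := fun a ha => by simp [hSdef, ha]
  have htS : t.atoms ⊆ S := fun a ha => by simp [hSdef, ha]
  have hsS : s.atoms ⊆ S := fun a ha => by simp [hSdef, ha]
  set G := Υ.symmetries hΥ S hS with hG
  have memG : ∀ X (π : FinPerm 𝔸), π.dom ⊆ Υ.freshAtoms X ∪ (S : Set 𝔸)ᶜ → π ∈ G X :=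
    fun X π hπ => ⟨π, 1, hπ, one_mem _, (mul_one π).symm⟩
  have hGS : ∀ X (π : FinPerm 𝔸), Disjoint π.dom S → π ∈ G X := fun X π hπ =>
    memG X π (hπ.subset_compl_right.trans Set.subset_union_right)
  let M := termAlgebra Sg G S hGS
  let v : 𝕍 → M.carrier := fun X => Quotient.mk _ (.susp 1 X)
  have hv : ∀ X (π : FinPerm 𝔸), π ∈ G X → π • v X = v X := fun X π hπ =>
    Quotient.sound (AlphaEq.susp _ _ _ (by simpa using hπ))
  -- Renamed fresh atoms are either unchanged or, for names, sent outside `S`; both kinds may be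
  -- permuted freely by `G X`.
  have hfixed : ∀ ρ, Generic Υ.names S ρ → ∀ (π : FinPerm 𝔸) (X : 𝕍),
      π.dom ⊆ Υ.freshAtoms X → ρ * π * ρ⁻¹ ∈ G X := by
    intro ρ hρ π X hπ
    refine memG X _ fun a ha => ?_
    obtain ⟨b, hb, rfl⟩ := FinPerm.mem_dom_conj ha
    by_cases hbN : b ∈ Υ.names
    · exact Or.inr (hρ.1 b hbN)
    · rw [hρ.2 b (hS (Υ.freshAtoms_subset_atoms X (hπ hb))) hbN]
      exact Or.inl (hπ hb)
  have hctx : M.CtxValid v Υ := by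
    rintro ⟨π, X⟩ hπ
    refine newSet_of_generic S fun ρ hρ => hv X _ ?_
    have hnew : (π.newPart Υ.names).dom ⊆ Υ.freshAtoms X := fun a ha => Or.inr ⟨π, hπ, ha⟩
    have hold : π.oldPart Υ.names ∈ Υ.fixPerms X := ⟨π, hπ, rfl⟩
    have hconj : ρ * π.oldPart Υ.names * ρ⁻¹ = π.oldPart Υ.names :=
      FinPerm.conj_eq_self fun a ha =>
        hρ.2 a (hS (FixCtx.fixPerms_dom hold ha).1) (FixCtx.fixPerms_dom hold ha).2
    have hmem : π.oldPart Υ.names ∈ G X :=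
      ⟨1, _, by simp, Subgroup.subset_closure hold, (one_mul _).symm⟩
    have hsplit : ρ * π * ρ⁻¹ = (ρ * π.newPart Υ.names * ρ⁻¹) * π.oldPart Υ.names := by
      conv_lhs => rw [← π.newPart_mul_oldPart Υ.names]
      conv_rhs => rw [← hconj]
      group
    rw [hsplit]
    exact mul_mem (hfixed ρ hρ _ X hnew) hmem
  obtain ⟨ρ, hρ, heq⟩ := exists_generic_of_newSet S (h M v hctx)
  -- A generic `ρ` moves only names and atoms outside `S`, so it lies in each `G X`.
  have hρv : ∀ X, ρ • v X = v X := fun X => hv X ρ (memG X ρ fun a ha => by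
    by_cases haN : a ∈ Υ.names
    · exact Or.inl (Or.inl haN)
    · exact Or.inr fun haS => ha (hρ.2 a haS haN))
  rw [M.interp_rename v ρ hρv, M.interp_rename v ρ hρv, smul_left_cancel_iff,
    termAlgebra_interp, termAlgebra_interp] at heq
  exact AlphaEq.derivable (Quotient.exact heq) Υ (fun _ => subset_rfl) (fun _ => subset_rfl)
    (htS.trans Set.subset_union_left) (hsS.trans Set.subset_union_left)

end NominalC

theorem mainTheorem1 {𝔸 𝕍 : Type} [DecidableEq 𝔸] [Countable 𝔸] [Infinite 𝔸]
    [Countable 𝕍] [Infinite 𝕍] (Sg : NominalC.Signature.{u})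
    (Υ : NominalC.FixCtx 𝔸 𝕍) (hΥ : Υ.IsNormal) (t s : NominalC.Term 𝔸 𝕍 Sg) :
    (NominalC.Derivable Υ t s → NominalC.Valid.{u, w} Υ t s) ∧
      (NominalC.Valid.{u, u} Υ t s → NominalC.Derivable Υ t s) :=
  ⟨fun h => h.valid hΥ, fun h => h.derivable hΥ⟩
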